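/- All graphs are finite and simple, and $\mu(G)$ denotes the size of a maximum matching of $G$. For a real $\alpha$ and an integer $f\ge 0$, a subgraph $H$ of a graph $G=(V,E)$ is an *$\alpha$-approximation $f$-tolerant subgraph* of $G$ if $\mu(G\setminus F)\le \alpha\cdot\mu(H\setminus F)$ for every $F\subseteq E$ with $|F|\le f$. A graph is an *$(r,t)$-Ruzsa–Szemerédi graph* if its edge set can be partitioned into $t$ induced matchings, each with exactly $r$ edges. 1. (Lower bound.) For every $\varepsilon>0$ there is a constant $c=c(\varepsilon)>0$ such that for every $f=f(n)$ with $f=\Theta(n)$ we have $n^{1+c/\log\log n}=\omega(f)$, and for all sufficiently large $n$ there is a graph $G$ on $n$ vertices all of whose $(3/2-\varepsilon)$-approximation $f$-tolerant subgraphs have at least $n^{1+c/\log\log n}$ edges. Moreover, a lower-bound graph is obtained from a Ruzsa–Szemerédi graph by attaching a pendant perfect matching: 2. (Existence.) For every $0<\delta<1$ there is a constant $c>0$ such that for all sufficiently large $N$ there is an $(r,t)$-Ruzsa–Szemerédi graph on $N$ vertices with $r=\lfloor(1-\delta)N/4\rfloor$ and $t\ge N^{c/\log\log N}$. 3. (The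 lower-bound graph.) For all $\varepsilon$, all $0<\delta<1$ with $\delta<\varepsilon/4$, and all $c>0$ there is a constant $c'>0$ such that the following holds for all sufficiently large $N$. Let $G_1$ be any $(r,t)$-Ruzsa–Szemerédi graph on $N$ vertices with $r=\lfloor(1-\delta)N/4\rfloor$ and $t\ge N^{c/\log\log N}$, and let $G$ be the graph on $n=2N$ vertices consisting of $G_1$ and $N$ additional vertices joined to the vertices of $G_1$ by a perfect matching. Then for every integer $f\ge(1-\delta)n/4$, every $(3/2-\varepsilon)$-approximation $f$-tolerant subgraph of $G$ has at least $n^{1+c'/\log\log n}$ edges. -/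

import Mathlib

open Filter Asymptotics

/-- The size `μ(G)` of a maximum matching of `G`. -/
noncomputable def matchingNumber {V : Type*} (G : SimpleGraph V) : ℕ :=
  sSup {k : ℕ | ∃ M : G.Subgraph, M.IsMatching ∧ M.edgeSet.ncard = k}

/-- The set whose supremum defines `matchingNumber` is bounded on a finite vertex type,
so the supremum is a maximum. -/
theorem matchingNumber_bddAbove {V : Type*} [Finite V] (G : SimpleGraph V) :
    BddAbove {k : ℕ | ∃ M : G.Subgraph, M.IsMatching ∧ M.edgeSet.ncard = k} := by
  refine ⟨G.edgeSet.ncard, ?_⟩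
  rintro k ⟨M, -, rfl⟩
  exact Set.ncard_le_ncard M.edgeSet_subset (Set.toFinite _)

/-- `H` is an `α`-approximation `f`-tolerant subgraph of `G`: for every set `F` of at most `f`
edges of `G`, the maximum matching of `H \ F` is an `α`-approximation to that of `G \ F`. -/
def IsTolerantSubgraph {V : Type*} (α : ℝ) (f : ℕ) (G H : SimpleGraph V) : Prop :=
  H ≤ G ∧ ∀ F : Finset (Sym2 V), (F : Set (Sym2 V)) ⊆ G.edgeSet → F.card ≤ f →
    (matchingNumber (G.deleteEdges (F : Set (Sym2 V))) : ℝ) ≤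
      α * (matchingNumber (H.deleteEdges (F : Set (Sym2 V))) : ℝ)

/-- `G` is an `(r, t)`-Ruzsa–Szemerédi graph: its edge set can be partitioned into `t` induced
matchings, each with exactly `r` edges. -/
def IsRuzsaSzemeredi {V : Type*} (G : SimpleGraph V) (r t : ℕ) : Prop :=
  ∃ M : Fin t → G.Subgraph,
    (∀ i, (M i).IsMatching ∧ (M i).IsInduced ∧ (M i).edgeSet.ncard = r) ∧
    (∀ i j, i ≠ j → Disjoint (M i).edgeSet (M j).edgeSet) ∧
    (⋃ i, (M i).edgeSet) = G.edgeSet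

/-- The graph consisting of `G` (on the left copy of `V`) together with one new vertex for each
`v : V` (the right copy), joined to `v` only: a pendant perfect matching attached to `G`. -/
def attachPendantMatching {V : Type*} (G : SimpleGraph V) : SimpleGraph (V ⊕ V) where
  Adj
    | Sum.inl a, Sum.inl b => G.Adj a b
    | Sum.inl a, Sum.inr b => a = b
    | Sum.inr a, Sum.inl b => a = b
    | Sum.inr _, Sum.inr _ => False
  symm := ⟨by
    rintro (a | a) (b | b) h
    · exact G.adj_symm h
    · exact Eq.symm h
    · exact Eq.symm h
    · exact h⟩
  loopless := ⟨by
    rintro (a | a) h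
    · exact G.irrefl h
    · exact h⟩

/-- The function `n ^ (1 + c / log log n)`. -/
noncomputable def rsEdgeBound (c : ℝ) (n : ℕ) : ℝ :=
  (n : ℝ) ^ (1 + c / Real.log (Real.log (n : ℝ)))

/-! Let `M` be an induced matching of `G₁` with `r ≈ N/4` edges, and delete the `2r` pendant edges
at its vertices. In the full graph, `M` and the surviving pendant edges form a matching of size `N -
r ≈ 3N/4`. In a subgraph `H`, since `M` is induced, every surviving edge outside `M` meets one of
the `N - 2r ≈ N/2` vertices of `G₁` off `M`. A ratio below `3/2` thus forces `H` to keep linearly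
many edges of `M` (`IsTolerantSubgraph.card_sub_le`), and summing over `t` disjoint matchings gives
`Ω(tN)` edges (`IsRuzsaSzemeredi.mul_le_ncard_edgeSet`).

The Ruzsa–Szemerédi graphs come from a code of words of length `a` that pairwise agree in fewer than
`h` places (`exists_code`). On `A = (ℤ/2a)^{a × q}` let `v c` be the indicator of the graph of the
word `c`, and `φ c` the sum of the coordinates over that graph. The matching of `c` joins `x` on the
left to `x + v c` on the right when `φ c x ∈ [0, a - h)`. Adding `v c` raises `φ c` by `a`, while
adding `v d` with `d ≠ c` raises it by less than `h`. So no edge of `d` joins a left endpoint of the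
matching of `c` to a right one. The density `(a - h) / (2a)` is close to `1/2` when `h/a` is small,
which gives matchings of size close to `N/4`.

If `f = Θ(n)` has a small constant, the construction is made on a small fraction of the vertices and
padded with isolated ones (`IsTolerantSubgraph.comap`). -/

/-! ### Codes with few pairwise agreements. -/

/-- Gilbert–Varshamov bound: words of length `a` over an alphabet of size `q` that pairwise agree
in fewer than `h` places. -/
theorem exists_code (a q h : ℕ) (hq : 0 < q) (ha : h ≤ a) (hqa : 4 ^ a ≤ q ^ h) :
    ∃ C : Finset (Fin a → Fin q), 2 ^ a ≤ C.card ∧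
      ∀ c ∈ C, ∀ d ∈ C, c ≠ d → (Finset.univ.filter fun i => c i = d i).card < h := by
  classical
  let P : Finset (Fin a → Fin q) → Prop := fun C =>
    ∀ c ∈ C, ∀ d ∈ C, c ≠ d → (Finset.univ.filter fun i => c i = d i).card < h
  obtain ⟨C, hC⟩ := (Set.toFinite {C | P C}).exists_maximal ⟨∅, by simp [P]⟩
  refine ⟨C, ?_, hC.prop⟩
  -- By maximality: an uncovered word could be added to `C`.
  have hcov : ∀ w : Fin a → Fin q, ∃ c ∈ C, h ≤ (Finset.univ.filter fun i => c i = w i).card := by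
    intro w
    by_contra! hw
    have hins : P (insert w C) := by
      intro c hc d hd hcd
      rw [Finset.mem_insert] at hc hd
      rcases hc with rfl | hc <;> rcases hd with rfl | hd
      · exact absurd rfl hcd
      · simpa only [eq_comm] using hw d hd
      · exact hw c hc
      · exact hC.prop c hc d hd hcd
    have hwC : w ∈ C := hC.le_of_ge hins (Finset.subset_insert w C) (Finset.mem_insert_self w C)
    have := hw w hwC
    simp at this
    omega
  -- A covered word lies in a box that fixes `h` of its coordinates to those of a codeword. There
  -- are at most `|C| * 2 ^ a` boxes, each of size `q ^ (a - h)`.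
  have hsub : (Finset.univ : Finset (Fin a → Fin q)) ⊆
      (C ×ˢ Finset.powersetCard h Finset.univ).biUnion fun cT =>
        Fintype.piFinset fun i => if i ∈ cT.2 then {cT.1 i} else Finset.univ := by
    intro w _
    obtain ⟨c, hc, hcw⟩ := hcov w
    obtain ⟨T, hT, hTh⟩ := Finset.exists_subset_card_eq hcw
    rw [Finset.mem_biUnion]
    refine ⟨(c, T), by simp [hc, hTh], ?_⟩
    rw [Fintype.mem_piFinset]
    intro i
    split_ifs with hi
    · have := hT hi
      simp at this ⊢
      exact this.symm
    · simp
  have hcard := (Finset.card_le_card hsub).trans Finset.card_biUnion_le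
  have hterm : ∀ cT ∈ C ×ˢ Finset.powersetCard h (Finset.univ : Finset (Fin a)),
      (Fintype.piFinset fun i => if i ∈ cT.2 then ({cT.1 i} : Finset (Fin q))
        else Finset.univ).card = q ^ (a - h) := by
    rintro ⟨c, T⟩ hcT
    have hT : T.card = h := by simpa using (Finset.mem_product.1 hcT).2
    rw [Fintype.card_piFinset]
    have : ∀ i, (if i ∈ T then ({c i} : Finset (Fin q)) else Finset.univ).card =
        if i ∈ T then 1 else q := by
      intro i; split_ifs <;> simp
    simp only [this, Finset.prod_ite, Finset.prod_const_one, one_mul, Finset.prod_const]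
    congr 1
    have : (Finset.univ.filter fun i => i ∉ T) = Tᶜ := by ext; simp
    rw [this, Finset.card_compl, hT, Fintype.card_fin]
  rw [Finset.sum_congr rfl hterm, Finset.sum_const, smul_eq_mul, Finset.card_product,
    Finset.card_powersetCard] at hcard
  simp only [Finset.card_univ, Fintype.card_pi, Fintype.card_fin, Finset.prod_const] at hcard
  have hpos : 0 < q ^ (a - h) := pow_pos hq _
  have h1 : q ^ h * q ^ (a - h) ≤ (C.card * 2 ^ a) * q ^ (a - h) := by
    rw [← pow_add, Nat.add_sub_cancel' ha]
    exact hcard.trans (by gcongr; exact Nat.choose_le_two_pow _ _)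
  have h2 := hqa.trans (Nat.le_of_mul_le_mul_right h1 hpos)
  have h3 : 2 ^ a * 2 ^ a ≤ C.card * 2 ^ a := by rwa [← mul_pow]
  exact Nat.le_of_mul_le_mul_right h3 (by positivity)

/-! ### Ruzsa–Szemerédi graphs from translations. -/

/-- A family of partial injections `σ i : S i → X` such that `σ j x = σ i x'` with
`x ∈ S i ∩ S j`, `x' ∈ S i` forces `i = j` gives a bipartite Ruzsa–Szemerédi graph. -/
theorem exists_isRuzsaSzemeredi_of_injections {X : Type*} {V : Type*} {t r : ℕ}
    (e : X ⊕ X ↪ V) (S : Fin t → Finset X) (σ : Fin t → X → X)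
    (hσ : ∀ i, Function.Injective (σ i)) (hr : ∀ i, r ≤ (S i).card)
    (hind : ∀ i j x x', x ∈ S i → x' ∈ S i → x ∈ S j → σ j x = σ i x' → i = j) :
    ∃ G : SimpleGraph V, IsRuzsaSzemeredi G r t := by
  classical
  -- The matchings need exactly `r` edges; shrinking `S i` keeps them induced.
  choose T hTS hT using fun i => Finset.exists_subset_card_eq (hr i)
  have hl : ∀ x y, e (Sum.inl x) = e (Sum.inl y) ↔ x = y := fun x y => by simp
  have hrr : ∀ x y, e (Sum.inr x) = e (Sum.inr y) ↔ x = y := fun x y => by simp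
  have hlr : ∀ x y, e (Sum.inl x) ≠ e (Sum.inr y) := fun x y => by simp
  let R : Fin t → V → V → Prop := fun i u v => ∃ x ∈ T i,
    (u = e (Sum.inl x) ∧ v = e (Sum.inr (σ i x))) ∨ (v = e (Sum.inl x) ∧ u = e (Sum.inr (σ i x)))
  have hRsymm : ∀ i u v, R i u v → R i v u := by
    rintro i u v ⟨x, hx, h⟩
    exact ⟨x, hx, h.symm⟩
  let G : SimpleGraph V :=
    { Adj := fun u v => ∃ i, R i u v
      symm := ⟨fun u v ⟨i, h⟩ => ⟨i, hRsymm i u v h⟩⟩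
      loopless := ⟨by
        rintro u ⟨i, x, hx, ⟨h1, h2⟩ | ⟨h1, h2⟩⟩
        · exact hlr _ _ (h1.symm.trans h2)
        · exact hlr _ _ (h1.symm.trans h2)⟩ }
  let M : Fin t → G.Subgraph := fun i =>
    { verts := {u | ∃ v, R i u v}
      Adj := R i
      adj_sub := fun h => ⟨i, h⟩
      edge_vert := fun h => ⟨_, h⟩
      symm := ⟨hRsymm i⟩ }
  have hedge : ∀ i, (M i).edgeSet =
      (fun x => s(e (Sum.inl x), e (Sum.inr (σ i x)))) '' (T i : Set X) := by
    intro i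
    ext z
    induction z with
    | h u v =>
      rw [SimpleGraph.Subgraph.mem_edgeSet]
      constructor
      · rintro ⟨x, hx, ⟨rfl, rfl⟩ | ⟨rfl, rfl⟩⟩
        · exact ⟨x, hx, rfl⟩
        · exact ⟨x, hx, Sym2.eq_swap⟩
      · rintro ⟨x, hx, h⟩
        rw [Sym2.eq_iff] at h
        rcases h with ⟨h1, h2⟩ | ⟨h1, h2⟩
        · exact ⟨x, hx, Or.inl ⟨h1.symm, h2.symm⟩⟩
        · exact ⟨x, hx, Or.inr ⟨h1.symm, h2.symm⟩⟩
  refine ⟨G, M, fun i => ⟨?_, ?_, ?_⟩, ?_, ?_⟩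
  · rintro u ⟨v, huv⟩
    refine ⟨v, huv, ?_⟩
    rintro w ⟨y, hy, hyw⟩
    obtain ⟨x, hx, hxv⟩ := huv
    rcases hxv with ⟨rfl, rfl⟩ | ⟨rfl, rfl⟩ <;> rcases hyw with ⟨h1, rfl⟩ | ⟨rfl, h1⟩
    · rw [(hl _ _).1 h1]
    · exact absurd h1 (hlr _ _)
    · exact absurd h1.symm (hlr _ _)
    · rw [hσ i ((hrr _ _).1 h1)]
  · rintro u ⟨u', x, hx, hxu⟩ v ⟨v', y, hy, hyv⟩ ⟨j, z, hz, huv⟩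
    have key : ∀ x y, x ∈ T i → y ∈ T i → z = x → σ j z = σ i y → j = i ∧ x = y := by
      rintro x y hx hy rfl h
      obtain rfl := hind i j z y (hTS i hx) (hTS i hy) (hTS j hz) h
      exact ⟨rfl, hσ _ h⟩
    rcases hxu with ⟨rfl, -⟩ | ⟨-, rfl⟩ <;> rcases hyv with ⟨rfl, -⟩ | ⟨-, rfl⟩ <;>
      rcases huv with ⟨h1, h2⟩ | ⟨h1, h2⟩ <;>
      first
        | exact absurd h1 (hlr _ _) | exact absurd h2 (hlr _ _)
        | exact absurd h1.symm (hlr _ _) | exact absurd h2.symm (hlr _ _)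
        | skip
    · obtain ⟨rfl, rfl⟩ := key x y hx hy ((hl _ _).1 h1).symm ((hrr _ _).1 h2).symm
      exact ⟨x, hx, Or.inl ⟨rfl, rfl⟩⟩
    · obtain ⟨rfl, rfl⟩ := key y x hy hx ((hl _ _).1 h1).symm ((hrr _ _).1 h2).symm
      exact ⟨y, hy, Or.inr ⟨rfl, rfl⟩⟩
  · rw [hedge, Set.ncard_image_of_injective, Set.ncard_coe_finset, hT]
    intro x y hxy
    simp only [Sym2.eq_iff] at hxy
    rcases hxy with ⟨h, -⟩ | ⟨h, -⟩
    · exact (hl _ _).1 h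
    · exact absurd h (hlr _ _)
  · intro i j hij
    rw [hedge, hedge, Set.disjoint_left]
    rintro _ ⟨x, hx, rfl⟩ ⟨y, hy, hxy⟩
    rw [Sym2.eq_iff] at hxy
    rcases hxy with ⟨h1, h2⟩ | ⟨h1, -⟩
    · obtain rfl := (hl _ _).1 h1
      exact hij (hind i j y y (hTS i hx) (hTS i hx) (hTS j hy) ((hrr _ _).1 h2))
    · exact hlr _ _ h1
  · ext z
    induction z with
    | h u v =>
      simp only [Set.mem_iUnion, SimpleGraph.Subgraph.mem_edgeSet, SimpleGraph.mem_edgeSet]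
      rfl

/-- The values of a surjective homomorphism to `ZMod n` are equidistributed. -/
theorem card_filter_val_lt {A : Type*} [AddGroup A] [Fintype A] {n : ℕ} [NeZero n]
    (φ : A →+ ZMod n) (hφ : Function.Surjective φ) {b : ℕ} (hb : b ≤ n) :
    n * (Finset.univ.filter fun x => (φ x).val < b).card = b * Fintype.card A := by
  classical
  obtain ⟨m, hm⟩ : ∃ m, ∀ y, (Finset.univ.filter fun x => φ x = y).card = m :=
    ⟨_, fun y => AddMonoidHom.card_fiber_eq_of_mem_range φ (hφ y) (hφ 0)⟩
  have h1 : (Finset.univ.filter fun x => (φ x).val < b).card =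
      (Finset.univ.filter fun y : ZMod n => y.val < b).card * m := by
    rw [Finset.card_eq_sum_card_fiberwise (f := φ)
      (t := Finset.univ.filter fun y : ZMod n => y.val < b)]
    · rw [Finset.sum_congr rfl (g := fun _ => m), Finset.sum_const, smul_eq_mul]
      intro y hy
      rw [← hm y, Finset.filter_filter]
      congr 1
      ext x
      simp only [Finset.mem_filter, Finset.mem_univ, true_and] at hy ⊢
      constructor
      · exact fun h => h.2
      · rintro rfl; exact ⟨hy, rfl⟩
    · intro x hx
      simpa using hx
  have h2 : Fintype.card A = n * m := by
    rw [← Finset.card_univ, Finset.card_eq_sum_card_fiberwise (f := φ) (t := Finset.univ)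
      (by intro x hx; simp)]
    simp [hm, ZMod.card]
  have h3 : (Finset.univ.filter fun y : ZMod n => y.val < b).card = b := by
    rw [← Finset.card_range b]
    refine Finset.card_bij (fun y _ => y.val) (by simp) ?_ ?_
    · intro x _ y _ h; exact ZMod.val_injective n h
    · intro k hk
      have hk' : k < b := by simpa using hk
      refine ⟨(k : ZMod n), ?_, ZMod.val_natCast_of_lt (hk'.trans_le hb)⟩
      simpa [ZMod.val_natCast_of_lt (hk'.trans_le hb)] using hk'
  rw [h1, h2, h3]; ring

/-- Ruzsa–Szemerédi graphs from translations of `(ℤ/2a)^{a × q}` along the words of a code. -/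
theorem exists_isRuzsaSzemeredi_of_code {a q h k N r : ℕ} (ha : 0 < a) (hha : h ≤ a)
    (C : Finset (Fin a → Fin q))
    (hC : ∀ c ∈ C, ∀ d ∈ C, c ≠ d → (Finset.univ.filter fun i => c i = d i).card < h)
    (hN : 2 * (k * (2 * a) ^ (a * q)) ≤ N)
    (hr : 2 * a * r ≤ (a - h) * (k * (2 * a) ^ (a * q))) :
    ∃ G : SimpleGraph (Fin N), IsRuzsaSzemeredi G r C.card := by
  classical
  have : NeZero (2 * a) := ⟨by omega⟩
  let A := Fin a × Fin q → ZMod (2 * a)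
  have hA : Fintype.card A = (2 * a) ^ (a * q) := by simp [A, ZMod.card]
  let φ : (Fin a → Fin q) → A →+ ZMod (2 * a) := fun c =>
    { toFun := fun x => ∑ i, x (i, c i)
      map_zero' := Finset.sum_const_zero
      map_add' := fun x y => Finset.sum_add_distrib }
  let v : (Fin a → Fin q) → A := fun c p => if p.2 = c p.1 then 1 else 0
  have hφv : ∀ c d, φ c (v d) = ((Finset.univ.filter fun i => c i = d i).card : ZMod (2 * a)) := by
    intro c d
    simp [φ, v]
  have hφ : ∀ c, Function.Surjective (φ c) := by
    intro c y
    refine ⟨Pi.single (⟨0, ha⟩, c ⟨0, ha⟩) y, ?_⟩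
    change ∑ i, (Pi.single (⟨0, ha⟩, c ⟨0, ha⟩) y : A) (i, c i) = y
    rw [Finset.sum_eq_single ⟨0, ha⟩]
    · simp
    · intro i _ hi
      rw [Pi.single_eq_of_ne]
      intro h
      exact hi (Prod.ext_iff.1 h).1
    · simp
  let w : Fin C.card → (Fin a → Fin q) := fun i => (C.equivFin.symm i : Fin a → Fin q)
  have hwC : ∀ i, w i ∈ C := fun i => (C.equivFin.symm i).2
  have hwinj : ∀ i j, w i = w j → i = j := fun i j hij =>
    C.equivFin.symm.injective (Subtype.ext hij)
  -- Taking `k` disjoint copies of `A` on each side fills up `Fin N`; each matching runs through all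
  -- the copies.
  obtain ⟨e⟩ : Nonempty ((Fin k × A) ⊕ (Fin k × A) ↪ Fin N) := by
    rw [Function.Embedding.nonempty_iff_card_le]
    simp only [Fintype.card_sum, Fintype.card_prod, Fintype.card_fin, hA]
    omega
  refine exists_isRuzsaSzemeredi_of_injections e
    (fun i => Finset.univ ×ˢ Finset.univ.filter fun x => (φ (w i) x).val < a - h)
    (fun i p => (p.1, p.2 + v (w i))) ?_ ?_ ?_
  · rintro i ⟨x, y⟩ ⟨x', y'⟩ hxy
    simpa using hxy
  · intro i
    rw [Finset.card_product, Finset.card_univ, Fintype.card_fin]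
    have := card_filter_val_lt (φ (w i)) (hφ _) (b := a - h) (by omega)
    rw [hA] at this
    refine Nat.le_of_mul_le_mul_left (hr.trans ?_) (show 0 < 2 * a by omega)
    rw [mul_left_comm (2 * a), this]
    exact le_of_eq (by ring)
  · rintro i j ⟨x₁, x⟩ ⟨y₁, y⟩ hx hy - hxy
    by_contra hij
    simp only [Finset.mem_product, Finset.mem_filter, Finset.mem_univ, true_and] at hx hy
    have hxy' : x + v (w j) = y + v (w i) := (Prod.ext_iff.1 hxy).2
    have hs := congrArg (φ (w i)) hxy'
    rw [map_add, map_add, hφv, hφv] at hs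
    have hlt := hC _ (hwC i) _ (hwC j) fun h => hij (hwinj _ _ h)
    -- The equation is `φ x + m = φ y + a` modulo `2a`. Both sides are below `2a`, so it holds in
    -- `ℕ`, but the left side is below `a`.
    set m := (Finset.univ.filter fun l => w i l = w j l).card
    have hself : (Finset.univ.filter fun l => w i l = w i l).card = a := by simp
    rw [hself] at hs
    rw [← ZMod.natCast_zmod_val (φ (w i) x), ← ZMod.natCast_zmod_val (φ (w i) y)] at hs
    norm_cast at hs
    rw [ZMod.natCast_eq_natCast_iff, Nat.ModEq, Nat.mod_eq_of_lt (by omega),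
      Nat.mod_eq_of_lt (by omega)] at hs
    omega

/-! ### Asymptotics of `n ^ (1 + c / log log n)`. -/

theorem tendsto_log_log_natCast_atTop :
    Tendsto (fun n : ℕ => Real.log (Real.log (n : ℝ))) atTop atTop :=
  Real.tendsto_log_atTop.comp (Real.tendsto_log_atTop.comp tendsto_natCast_atTop_atTop)

theorem eventually_mul_log_log_le_log (C : ℝ) :
    ∀ᶠ n : ℕ in atTop, C * Real.log (Real.log (n : ℝ)) ≤ Real.log (n : ℝ) := by
  have ht : Tendsto (fun n : ℕ => Real.log (n : ℝ)) atTop atTop :=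
    Real.tendsto_log_atTop.comp tendsto_natCast_atTop_atTop
  have hb := ht.eventually (Real.isLittleO_log_id_atTop.bound
    (show 0 < 1 / (|C| + 1) by positivity))
  filter_upwards [hb, ht.eventually_ge_atTop 0] with n hn h0
  simp only [id, Real.norm_eq_abs, abs_of_nonneg h0] at hn
  rw [one_div, inv_mul_eq_div, le_div_iff₀ (by positivity)] at hn
  calc C * Real.log (Real.log n) ≤ |C * Real.log (Real.log n)| := le_abs_self _
    _ = |C| * |Real.log (Real.log n)| := abs_mul _ _
    _ ≤ |Real.log (Real.log n)| * (|C| + 1) := by nlinarith [abs_nonneg (Real.log (Real.log n))]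
    _ ≤ _ := hn

/-- Passing to a linear fraction of the vertices only costs a constant factor in the exponent. -/
theorem eventually_mul_rsEdgeBound_le {c c' K : ℝ} (hc : 0 < c) (hcc' : c < c') (hK : 1 ≤ K) :
    ∀ᶠ n : ℕ in atTop, ∀ M : ℕ, M ≤ n → (n : ℝ) ≤ K * M →
      K * rsEdgeBound c n ≤ rsEdgeBound c' M := by
  have ht : Tendsto (fun n : ℕ => Real.log (n : ℝ)) atTop atTop :=
    Real.tendsto_log_atTop.comp tendsto_natCast_atTop_atTop
  set k := Real.log K with hk
  have hk0 : 0 ≤ k := Real.log_nonneg hK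
  filter_upwards [eventually_mul_log_log_le_log ((2 * k + k * c') / (c' - c)),
    tendsto_log_log_natCast_atTop.eventually_ge_atTop 1, ht.eventually_ge_atTop (k + 2),
    eventually_gt_atTop 0] with n h1 h2 h3 hn M hMn hnM
  have hn' : (0 : ℝ) < n := by exact_mod_cast hn
  have hK0 : 0 < K := by linarith
  have hM : (0 : ℝ) < M := by
    by_contra h
    nlinarith [mul_nonpos_of_nonneg_of_nonpos hK0.le (not_lt.1 h)]
  set L := Real.log (n : ℝ) with hL
  set l := Real.log L with hl
  have hLM : L - k ≤ Real.log (M : ℝ) := by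
    have := Real.log_le_log hn' hnM
    rw [Real.log_mul hK0.ne' hM.ne'] at this
    linarith
  have hML : Real.log (M : ℝ) ≤ L := Real.log_le_log hM (by exact_mod_cast hMn)
  have hlM : Real.log (Real.log (M : ℝ)) ≤ l := Real.log_le_log (by linarith) hML
  have hlM0 : 0 < Real.log (Real.log (M : ℝ)) := Real.log_pos (by linarith)
  unfold rsEdgeBound
  rw [Real.rpow_def_of_pos hn', Real.rpow_def_of_pos hM]
  nth_rewrite 1 [← Real.exp_log hK0]
  rw [← Real.exp_add, Real.exp_le_exp, ← hk, ← hL, ← hl]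
  have hl0 : 0 < l := by linarith
  -- The smaller base `M` only helps the exponent. In logarithms, the gain `(c' - c) * L / l` is
  -- unbounded and absorbs the `O(k)` lost in the factor `K` and in `log M ≥ L - k`.
  have h4 : c' / l ≤ c' / Real.log (Real.log (M : ℝ)) :=
    div_le_div_of_nonneg_left (by linarith) hlM0 hlM
  have hc'l : 0 ≤ c' / l := div_nonneg (by linarith) hl0.le
  have h5 : (L - k) * (1 + c' / l) ≤
      Real.log (M : ℝ) * (1 + c' / Real.log (Real.log (M : ℝ))) := by
    apply mul_le_mul hLM (by linarith) (by linarith) (by linarith)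
  refine le_trans ?_ h5
  have h6 : (2 * k + k * c') * l ≤ (c' - c) * L := by
    rw [div_mul_eq_mul_div, div_le_iff₀ (by linarith)] at h1
    linarith
  have h7 : k + L * (1 + c / l) = (k * l + L * l + L * c) / l := by field_simp; ring
  have h8 : (L - k) * (1 + c' / l) = ((L - k) * l + (L - k) * c') / l := by field_simp
  rw [h7, h8]
  apply div_le_div_of_nonneg_right _ hl0.le
  nlinarith [mul_nonneg hk0 (show 0 ≤ c' by linarith)]

theorem eventually_natCast_le_rsEdgeBound {c : ℝ} (hc : 0 < c) :
    ∀ᶠ n : ℕ in atTop, (n : ℝ) ≤ rsEdgeBound c n := by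
  filter_upwards [tendsto_log_log_natCast_atTop.eventually_ge_atTop 1, eventually_ge_atTop 1]
    with n h1 h2
  unfold rsEdgeBound
  nth_rewrite 1 [← Real.rpow_one (n : ℝ)]
  refine Real.rpow_le_rpow_of_exponent_le (by exact_mod_cast h2) ?_
  have : 0 < c / Real.log (Real.log (n : ℝ)) := div_pos hc (by linarith)
  linarith

/-- Halving the constant in the exponent already gains any constant factor, so
`eventually_mul_rsEdgeBound_le` is applied with `M = n`. -/
theorem natCast_isLittleO_rsEdgeBound {c : ℝ} (hc : 0 < c) :
    (fun n : ℕ => (n : ℝ)) =o[atTop] rsEdgeBound c := by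
  rw [isLittleO_iff]
  intro κ hκ
  have hK : 1 ≤ max 1 κ⁻¹ := le_max_left _ _
  filter_upwards [eventually_mul_rsEdgeBound_le (half_pos hc) (half_lt_self hc) hK,
    eventually_natCast_le_rsEdgeBound (half_pos hc)] with n h1 h2
  have h3 := h1 n le_rfl (le_mul_of_one_le_left (Nat.cast_nonneg n) hK)
  have hn : (0 : ℝ) ≤ n := Nat.cast_nonneg n
  have h4 : κ⁻¹ * n ≤ rsEdgeBound c n :=
    (mul_le_mul (le_max_right _ _) h2 hn (by positivity)).trans h3
  rw [Real.norm_of_nonneg hn, Real.norm_of_nonneg (le_trans (by positivity) h4)]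
  rwa [inv_mul_le_iff₀ hκ] at h4

/-! ### Parameters and existence of the Ruzsa–Szemerédi graphs. -/

/-- The choice of the code length for a given number `N` of vertices. -/
theorem exists_code_length {s q : ℕ} {δ : ℝ} (hs : 0 < s) (hq : 0 < q) (hδ : 0 < δ) :
    ∃ c : ℝ, 0 < c ∧ ∀ᶠ N : ℕ in atTop, ∃ h : ℕ, 0 < h ∧
      (N : ℝ) ^ (c / Real.log (Real.log (N : ℝ))) ≤ 2 ^ (s * h) ∧
      2 * (2 * ((s * h : ℕ) : ℝ)) ^ (s * h * q) ≤ δ * N := by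
  have hs' : (1 : ℝ) ≤ s := by exact_mod_cast hs
  have hq' : (1 : ℝ) ≤ q := by exact_mod_cast hq
  have ht : Tendsto (fun n : ℕ => Real.log (n : ℝ)) atTop atTop :=
    Real.tendsto_log_atTop.comp tendsto_natCast_atTop_atTop
  -- With `h ≈ κ * L / l` and `a = s * h`, this makes `a * q * log (2a) ≤ L / 4`, so `|A| ≤ N ^
  -- (1/4)`.
  set κ : ℝ := 1 / (4 * s * q) with hκ
  have hκ0 : 0 < κ := by positivity
  have hlog2 : 0 < Real.log 2 := Real.log_pos one_lt_two
  -- The factor `1/2` pays for the floor in `h`, since `κ * L / l ≥ 2` eventually.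
  refine ⟨s * κ / 2 * Real.log 2, by positivity, ?_⟩
  filter_upwards [eventually_mul_log_log_le_log (2 / κ),
    tendsto_log_log_natCast_atTop.eventually_ge_atTop 1,
    ht.eventually_ge_atTop (4 / 3 * Real.log (2 / δ)), ht.eventually_ge_atTop 0,
    eventually_gt_atTop 0] with N h1 h2 h3 hL0 hN
  have hN' : (0 : ℝ) < N := by exact_mod_cast hN
  set L := Real.log (N : ℝ) with hL
  set l := Real.log L with hl
  have hl0 : 0 < l := by linarith
  have h4 : 2 ≤ κ * (L / l) := by
    rw [← mul_div_assoc, le_div_iff₀ hl0]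
    rw [div_mul_eq_mul_div, div_le_iff₀ hκ0] at h1
    linarith
  have hfl : (⌊κ * (L / l)⌋₊ : ℝ) ≤ κ * (L / l) := Nat.floor_le (by linarith)
  have hfl' : κ * (L / l) < ⌊κ * (L / l)⌋₊ + 1 := Nat.lt_floor_add_one _
  set h := ⌊κ * (L / l)⌋₊ with hh
  have hh0 : 0 < h := by
    have : (0 : ℝ) < h := by linarith
    exact_mod_cast this
  refine ⟨h, hh0, ?_, ?_⟩
  · rw [Real.rpow_def_of_pos hN', ← Real.rpow_natCast, Real.rpow_def_of_pos two_pos,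
      Real.exp_le_exp, ← hL]
    push_cast
    have : L * (s * κ / 2 * Real.log 2 / l) = Real.log 2 * (s * (κ * (L / l) / 2)) := by
      field_simp
    rw [this]
    gcongr
    linarith
  · have hsh : (0 : ℝ) < ((s * h : ℕ) : ℝ) := by exact_mod_cast Nat.mul_pos hs hh0
    have h5 : ((s * h : ℕ) : ℝ) * q * l ≤ L / 4 := by
      push_cast
      calc (s : ℝ) * h * q * l ≤ s * (κ * (L / l)) * q * l := by gcongr
        _ = L / 4 := by rw [hκ]; field_simp
    have h6 : 2 * ((s * h : ℕ) : ℝ) ≤ L := by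
      have : ((s * h : ℕ) : ℝ) * 1 * 1 ≤ ((s * h : ℕ) : ℝ) * q * l := by gcongr
      linarith
    have h7 : Real.log (2 * ((s * h : ℕ) : ℝ)) ≤ l := Real.log_le_log (by positivity) h6
    have h8 : (2 * ((s * h : ℕ) : ℝ)) ^ (s * h * q) ≤ Real.exp (L / 4) := by
      rw [← Real.rpow_natCast, Real.rpow_def_of_pos (by positivity), Real.exp_le_exp]
      refine le_trans ?_ h5
      rw [Nat.cast_mul (s * h) q, mul_comm]
      gcongr
    have h9 : 2 / δ ≤ Real.exp (3 / 4 * L) := by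
      rw [← Real.log_le_iff_le_exp (by positivity)]
      linarith
    calc 2 * (2 * ((s * h : ℕ) : ℝ)) ^ (s * h * q) ≤ 2 * Real.exp (L / 4) := by gcongr
      _ = δ * (2 / δ) * Real.exp (L / 4) := by field_simp
      _ ≤ δ * Real.exp (3 / 4 * L) * Real.exp (L / 4) := by gcongr
      _ = δ * N := by
        rw [mul_assoc, ← Real.exp_add, show 3 / 4 * L + L / 4 = L by ring, hL, Real.exp_log hN']

theorem exists_isRuzsaSzemeredi {δ : ℝ} (hδ0 : 0 < δ) (hδ1 : δ < 1) :
    ∃ c : ℝ, 0 < c ∧ ∀ᶠ N : ℕ in atTop, ∃ (G₁ : SimpleGraph (Fin N)) (t : ℕ),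
      (N : ℝ) ^ (c / Real.log (Real.log (N : ℝ))) ≤ (t : ℝ) ∧
      IsRuzsaSzemeredi G₁ ⌊(1 - δ) * (N : ℝ) / 4⌋₊ t := by
  -- The loss `δ` is split in two: `h / a = 1 / s ≤ δ / 2` for the density, and `δ / 2` for rounding
  -- `N` down to a multiple of `2 * A`. The alphabet size `4 ^ s` turns the condition of
  -- `exists_code` into an equality.
  obtain ⟨s, hs⟩ := exists_nat_ge (2 / δ)
  have hs0 : (0 : ℝ) < s := lt_of_lt_of_le (by positivity) hs
  have hsδ : 1 ≤ δ / 2 * s := by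
    rw [div_le_iff₀ hδ0] at hs
    linarith
  obtain ⟨c, hc, hev⟩ := exists_code_length (s := s) (q := 4 ^ s) (δ := δ / 2)
    (by exact_mod_cast hs0) (by positivity) (by positivity)
  refine ⟨c, hc, ?_⟩
  filter_upwards [hev] with N hN
  obtain ⟨h, hh, ht, hA⟩ := hN
  have hs1 : 0 < s := by exact_mod_cast hs0
  have hha : h ≤ s * h := Nat.le_mul_of_pos_left h hs1
  obtain ⟨C, hC, hCd⟩ := exists_code (s * h) (4 ^ s) h (by positivity) hha (by rw [← pow_mul])
  set A := (2 * (s * h)) ^ (s * h * 4 ^ s) with hAdef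
  have hA0 : 0 < A := by positivity
  have hA' : 2 * (A : ℝ) ≤ δ / 2 * N := by rw [hAdef]; exact_mod_cast hA
  set k := N / (2 * A) with hk
  have hkN : 2 * (k * A) ≤ N := by
    have := Nat.div_mul_le_self N (2 * A)
    rw [← hk] at this
    linarith
  have hkN' : (1 - δ / 2) * N ≤ 2 * (k * A) := by
    have h1 : N < 2 * A * (k + 1) := Nat.lt_mul_div_succ N (by positivity)
    have h2 : (N : ℝ) < 2 * A * (k + 1) := by exact_mod_cast h1
    linarith
  have hr : 2 * (s * h) * ⌊(1 - δ) * (N : ℝ) / 4⌋₊ ≤ (s * h - h) * (k * A) := by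
    have hfl : (⌊(1 - δ) * (N : ℝ) / 4⌋₊ : ℝ) ≤ (1 - δ) * N / 4 :=
      Nat.floor_le (by have : 0 < 1 - δ := by linarith
                       positivity)
    have hN0 : (0 : ℝ) ≤ N := Nat.cast_nonneg N
    have hkA : (0 : ℝ) ≤ k * A := by positivity
    have : ((2 * (s * h) * ⌊(1 - δ) * (N : ℝ) / 4⌋₊ : ℕ) : ℝ) ≤
        (((s * h - h) * (k * A) : ℕ) : ℝ) := by
      push_cast [Nat.cast_sub hha]
      calc 2 * ((s : ℝ) * h) * ⌊(1 - δ) * (N : ℝ) / 4⌋₊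
          ≤ 2 * ((s : ℝ) * h) * ((1 - δ) * N / 4) := by gcongr
        _ = h * (s * (1 - δ) * N / 2) := by ring
        _ ≤ h * ((s - 1) * (k * A)) := by
          gcongr
          have e1 : s * (1 - δ / 2) ≤ (s : ℝ) - 1 := by linarith
          have e2 : s * (1 - δ / 2) * (k * A) ≤ ((s : ℝ) - 1) * (k * A) := by gcongr
          have e3 : s * (1 - δ / 2) * ((1 - δ / 2) * N) ≤ s * (1 - δ / 2) * (2 * (k * A)) := by
            have : 0 < 1 - δ / 2 := by linarith
            gcongr
          have e4 : s * N * (1 - δ) ≤ s * N * ((1 - δ / 2) * (1 - δ / 2)) := by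
            gcongr
            nlinarith
          linarith
        _ = _ := by ring
    exact_mod_cast this
  obtain ⟨G, hG⟩ := exists_isRuzsaSzemeredi_of_code (Nat.mul_pos hs1 hh) hha C hCd hkN hr
  exact ⟨G, C.card, ht.trans (by exact_mod_cast hC), hG⟩

/-! ### Matching numbers and tolerance. -/

theorem SimpleGraph.Subgraph.IsMatching.ncard_verts {V : Type*} [Finite V] {G : SimpleGraph V}
    {M : G.Subgraph} (hM : M.IsMatching) : M.verts.ncard = 2 * M.edgeSet.ncard := by
  classical
  have := Fintype.ofFinite V
  have hsum := M.spanningCoe.sum_degrees_eq_twice_card_edges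
  have hdeg : ∀ v, M.spanningCoe.degree v = if v ∈ M.verts then 1 else 0 := by
    intro v
    split_ifs with hv
    · obtain ⟨w, hw, hu⟩ := hM hv
      rw [SimpleGraph.degree_eq_one_iff_existsUnique_adj]
      exact ⟨w, hw, hu⟩
    · rw [← SimpleGraph.card_neighborFinset_eq_degree, Finset.card_eq_zero,
        Finset.eq_empty_iff_forall_notMem]
      intro w hw
      rw [SimpleGraph.mem_neighborFinset] at hw
      exact hv (M.edge_vert hw)
  simp only [hdeg, Finset.sum_boole, Nat.cast_id] at hsum
  rw [← M.edgeSet_spanningCoe, ← SimpleGraph.coe_edgeFinset, Set.ncard_coe_finset, ← hsum,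
    ← Set.ncard_coe_finset]
  congr 1
  ext v
  simp

theorem ncard_edgeSet_le_matchingNumber {V : Type*} [Finite V] {G : SimpleGraph V}
    {M : G.Subgraph} (hM : M.IsMatching) : M.edgeSet.ncard ≤ matchingNumber G :=
  le_csSup (matchingNumber_bddAbove G) ⟨M, hM, rfl⟩

theorem matchingNumber_le {V : Type*} {G : SimpleGraph V} {k : ℕ}
    (h : ∀ M : G.Subgraph, M.IsMatching → M.edgeSet.ncard ≤ k) : matchingNumber G ≤ k := by
  refine csSup_le ⟨0, ⊥, fun v hv => absurd hv (by simp), by simp⟩ ?_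
  rintro _ ⟨M, hM, rfl⟩
  exact h M hM

theorem IsTolerantSubgraph.mono_left {V : Type*} {α β : ℝ} {f : ℕ} {G H : SimpleGraph V}
    (h : IsTolerantSubgraph α f G H) (hαβ : α ≤ β) : IsTolerantSubgraph β f G H :=
  ⟨h.1, fun F hF hf => (h.2 F hF hf).trans (by gcongr)⟩

/-- Adding isolated vertices does not affect tolerance. -/
theorem IsTolerantSubgraph.comap {U V : Type*} [Finite U] [Finite V] {α : ℝ} (hα : 0 ≤ α) {f : ℕ}
    {G : SimpleGraph U} (e : U ↪ V) {H : SimpleGraph V}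
    (h : IsTolerantSubgraph α f (G.map e) H) : IsTolerantSubgraph α f G (H.comap e) := by
  classical
  have hHG : ∀ {u v}, H.Adj u v → ∃ a b, G.Adj a b ∧ e a = u ∧ e b = v := by
    intro u v huv
    have := h.1 huv
    rwa [SimpleGraph.map_adj] at this
  have hadj : ∀ {a b}, H.Adj (e a) (e b) → G.Adj a b := by
    intro a b hab
    simpa using h.1 hab
  refine ⟨fun a b hab => hadj hab, fun F hF hf => ?_⟩
  have hinj : Function.Injective (Sym2.map e) := Sym2.map.injective e.injective
  set F' : Finset (Sym2 V) := F.image (Sym2.map e) with hF'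
  have hFF' : ∀ a b, s(e a, e b) ∈ (F' : Set (Sym2 V)) ↔ s(a, b) ∈ (F : Set (Sym2 U)) := by
    intro a b
    rw [← Sym2.map_mk, hF', Finset.coe_image]
    exact hinj.mem_set_image
  have hF'G : (F' : Set (Sym2 V)) ⊆ (G.map e).edgeSet := by
    intro z hz
    rw [hF', Finset.coe_image] at hz
    obtain ⟨y, hy, rfl⟩ := hz
    have := hF hy
    induction y with
    | h a b => simpa using this
  have hmain := h.2 F' hF'G (Finset.card_image_le.trans hf)
  have hlow : matchingNumber (G.deleteEdges (F : Set (Sym2 U))) ≤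
      matchingNumber ((G.map e).deleteEdges (F' : Set (Sym2 V))) := by
    refine matchingNumber_le fun M hM => ?_
    let g : G.deleteEdges (F : Set (Sym2 U)) →g (G.map e).deleteEdges (F' : Set (Sym2 V)) :=
      { toFun := e
        map_rel' := by
          intro a b hab
          rw [SimpleGraph.deleteEdges_adj] at hab ⊢
          exact ⟨by simpa using hab.1, fun h' => hab.2 ((hFF' a b).1 h')⟩ }
    have := ncard_edgeSet_le_matchingNumber (hM.map g e.injective)
    rwa [SimpleGraph.Subgraph.edgeSet_map,
      Set.ncard_image_of_injective _ (show Function.Injective (Sym2.map g) from hinj)] at this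
  have hupp : matchingNumber (H.deleteEdges (F' : Set (Sym2 V))) ≤
      matchingNumber ((H.comap e).deleteEdges (F : Set (Sym2 U))) := by
    refine matchingNumber_le fun M hM => ?_
    let g : (H.comap e).deleteEdges (F : Set (Sym2 U)) →g H.deleteEdges (F' : Set (Sym2 V)) :=
      { toFun := e
        map_rel' := by
          intro a b hab
          rw [SimpleGraph.deleteEdges_adj] at hab ⊢
          exact ⟨hab.1, fun h' => hab.2 ((hFF' a b).1 h')⟩ }
    have hMadj : ∀ {a b}, M.Adj (e a) (e b) → (M.comap g).Adj a b := by
      intro a b hab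
      refine ⟨?_, hab⟩
      have := M.adj_sub hab
      rw [SimpleGraph.deleteEdges_adj] at this ⊢
      exact ⟨this.1, fun h' => this.2 ((hFF' a b).2 h')⟩
    -- Matching partners pull back because every edge of `H` has both ends in the range of `e`.
    have hM' : (M.comap g).IsMatching := by
      intro a ha
      obtain ⟨w, hw, hu⟩ := hM (show e a ∈ M.verts from ha)
      obtain ⟨x, b, -, hx, rfl⟩ := hHG (SimpleGraph.deleteEdges_le _ (M.adj_sub hw))
      exact ⟨b, hMadj hw, fun y hy => e.injective (hu _ hy.2)⟩
    refine le_trans ?_ (ncard_edgeSet_le_matchingNumber hM')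
    rw [← Set.ncard_image_of_injective _ hinj]
    refine Set.ncard_le_ncard ?_ (Set.toFinite _)
    intro z hz
    induction z with
    | h u v =>
      rw [SimpleGraph.Subgraph.mem_edgeSet] at hz
      obtain ⟨a, b, -, rfl, rfl⟩ := hHG (SimpleGraph.deleteEdges_le _ (M.adj_sub hz))
      exact ⟨s(a, b), hMadj hz, rfl⟩
  calc (matchingNumber (G.deleteEdges (F : Set (Sym2 U))) : ℝ)
      ≤ matchingNumber ((G.map e).deleteEdges (F' : Set (Sym2 V))) := by exact_mod_cast hlow
    _ ≤ _ := hmain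
    _ ≤ _ := by gcongr

/-! ### Deleting the pendant edges at an induced matching. -/

section PendantMatching

variable {U : Type*} [Fintype U] {G : SimpleGraph U} {M : G.Subgraph}

/-- Deleting the pendant edges at the vertices of a matching `M` of `G` leaves a matching of size
`|U| - |M|`. -/
theorem card_le_matchingNumber_attachPendantMatching_deleteEdges (hM : M.IsMatching) :
    Fintype.card U ≤ matchingNumber ((attachPendantMatching G).deleteEdges
      ((fun v => s(Sum.inl v, Sum.inr v)) '' M.verts)) + M.edgeSet.ncard := by
  classical
  set G' := (attachPendantMatching G).deleteEdges ((fun v => s(Sum.inl v, Sum.inr v)) '' M.verts)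
    with hG'
  -- The edges of `M` together with the pendant edges off `M`.
  let R : U ⊕ U → U ⊕ U → Prop
    | Sum.inl a, Sum.inl b => M.Adj a b
    | Sum.inl a, Sum.inr b => a = b ∧ a ∉ M.verts
    | Sum.inr a, Sum.inl b => a = b ∧ a ∉ M.verts
    | Sum.inr _, Sum.inr _ => False
  have hnot : ∀ a, a ∉ M.verts →
      s(Sum.inl a, Sum.inr a) ∉ (fun v : U => s(Sum.inl v, Sum.inr v)) '' M.verts := by
    rintro a ha ⟨b, hb, hab⟩
    simp at hab
    exact ha (hab ▸ hb)
  have hRG : ∀ p q, R p q → G'.Adj p q := by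
    rintro (a | a) (b | b) h <;> rw [hG', SimpleGraph.deleteEdges_adj]
    · refine ⟨M.adj_sub h, ?_⟩
      rintro ⟨v, hv, hvab⟩
      simp at hvab
    · obtain ⟨rfl, ha⟩ := h
      exact ⟨rfl, hnot a ha⟩
    · obtain ⟨rfl, ha⟩ := h
      exact ⟨rfl, by rw [Sym2.eq_swap]; exact hnot a ha⟩
    · exact h.elim
  let K : G'.Subgraph :=
    { verts := Sum.inl '' Set.univ ∪ Sum.inr '' M.vertsᶜ
      Adj := R
      adj_sub := fun h => hRG _ _ h
      edge_vert := by
        rintro (a | a) (b | b) h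
        · exact Or.inl ⟨a, trivial, rfl⟩
        · exact Or.inl ⟨a, trivial, rfl⟩
        · exact Or.inr ⟨a, h.2, rfl⟩
        · exact h.elim
      symm := ⟨by
        rintro (a | a) (b | b) h
        · exact M.adj_symm h
        · exact ⟨h.1.symm, h.1 ▸ h.2⟩
        · exact ⟨h.1.symm, h.1 ▸ h.2⟩
        · exact h⟩ }
  have hK : K.IsMatching := by
    rintro _ (⟨a, -, rfl⟩ | ⟨a, ha, rfl⟩)
    · by_cases ha : a ∈ M.verts
      · obtain ⟨b, hb, hu⟩ := hM ha
        refine ⟨Sum.inl b, hb, ?_⟩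
        rintro (c | c) hc
        · rw [hu c hc]
        · exact absurd ha hc.2
      · refine ⟨Sum.inr a, ⟨rfl, ha⟩, ?_⟩
        rintro (c | c) hc
        · exact absurd (M.edge_vert hc) ha
        · rw [hc.1]
    · refine ⟨Sum.inl a, ⟨rfl, ha⟩, ?_⟩
      rintro (c | c) hc
      · rw [hc.1]
      · exact hc.elim
  have h1 := ncard_edgeSet_le_matchingNumber hK
  have h2 := hK.ncard_verts
  have h3 := hM.ncard_verts
  have h4 : K.verts.ncard = Fintype.card U + M.vertsᶜ.ncard := by
    change (Sum.inl '' Set.univ ∪ Sum.inr '' M.vertsᶜ : Set (U ⊕ U)).ncard = _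
    rw [Set.ncard_union_eq _ (Set.toFinite _) (Set.toFinite _),
      Set.ncard_image_of_injective _ Sum.inl_injective,
      Set.ncard_image_of_injective _ Sum.inr_injective, Set.ncard_univ, Nat.card_eq_fintype_card]
    rw [Set.disjoint_left]
    rintro _ ⟨a, -, rfl⟩ ⟨b, -, hb⟩
    cases hb
  have h5 := Set.ncard_add_ncard_compl M.verts
  rw [Nat.card_eq_fintype_card] at h5
  omega

/-- Once the pendant edges at an induced matching `M` of `G` are deleted, a subgraph has matching
number at most `|U| - 2|M|` plus the number of its edges in `M`. -/
theorem matchingNumber_deleteEdges_le_of_isInduced (hM : M.IsMatching) (hI : M.IsInduced)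
    {H : SimpleGraph (U ⊕ U)} (hH : H ≤ attachPendantMatching G) :
    matchingNumber (H.deleteEdges ((fun v => s(Sum.inl v, Sum.inr v)) '' M.verts)) +
      2 * M.edgeSet.ncard ≤
      Fintype.card U + (H.edgeSet ∩ Sym2.map Sum.inl '' M.edgeSet).ncard := by
  classical
  set D : Set (Sym2 (U ⊕ U)) := (fun v => s(Sum.inl v, Sum.inr v)) '' M.verts with hD
  have h3 := hM.ncard_verts
  have h5 := Set.ncard_add_ncard_compl M.verts
  rw [Nat.card_eq_fintype_card] at h5
  suffices h : matchingNumber (H.deleteEdges D) ≤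
      M.vertsᶜ.ncard + (H.edgeSet ∩ Sym2.map Sum.inl '' M.edgeSet).ncard by omega
  refine matchingNumber_le fun K hK => ?_
  -- Edges of `K` meeting a vertex of `G` off `M`. Choosing such a vertex on each is injective since
  -- `K` is a matching; the other edges of `K` lie in `M`.
  let E : Set (Sym2 (U ⊕ U)) := {z ∈ K.edgeSet | ∃ v ∉ M.verts, Sum.inl v ∈ z}
  have hE : E.ncard ≤ M.vertsᶜ.ncard := by
    have hex : ∀ z : Sym2 (U ⊕ U), ∃ v : U ⊕ U, z ∈ E → v ∈ Sum.inl '' M.vertsᶜ ∧ v ∈ z := by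
      intro z
      by_cases hz : z ∈ E
      · obtain ⟨-, v, hv, hvz⟩ := hz
        exact ⟨Sum.inl v, fun _ => ⟨⟨v, hv, rfl⟩, hvz⟩⟩
      · exact ⟨z.out.1, fun h => absurd h hz⟩
    choose g hg using hex
    rw [← Set.ncard_image_of_injective M.vertsᶜ (Sum.inl_injective (α := U) (β := U))]
    refine Set.ncard_le_ncard_of_injOn g (fun z hz => (hg z hz).1) ?_ (Set.toFinite _)
    intro z hz z' hz' hzz'
    -- Two edges of `K` with the same chosen vertex share it, hence coincide.
    obtain ⟨w, hw⟩ := Sym2.mem_iff_exists.1 (hg z hz).2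
    obtain ⟨w', hw'⟩ := Sym2.mem_iff_exists.1 (hg z' hz').2
    have k1 : K.Adj (g z) w := by
      rw [← SimpleGraph.Subgraph.mem_edgeSet, ← hw]; exact hz.1
    have k2 : K.Adj (g z) w' := by
      rw [← SimpleGraph.Subgraph.mem_edgeSet, hzz', ← hw']; exact hz'.1
    rw [hw, hw', ← hzz', hK.eq_of_adj_left k1 k2]
  have hsub : K.edgeSet ⊆ E ∪ (H.edgeSet ∩ Sym2.map Sum.inl '' M.edgeSet) := by
    intro z hz
    by_cases hzE : z ∈ E
    · exact Or.inl hzE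
    right
    have hv : ∀ v, Sum.inl v ∈ z → v ∈ M.verts := by
      intro v hv
      by_contra hvM
      exact hzE ⟨hz, v, hvM, hv⟩
    have hzH := K.edgeSet_subset hz
    rw [SimpleGraph.edgeSet_deleteEdges] at hzH
    refine ⟨hzH.1, ?_⟩
    have hpend : ∀ a b, s(Sum.inl a, Sum.inr b) = z → False := by
      rintro a b rfl
      have hab : a = b := hH hzH.1
      subst hab
      exact hzH.2 ⟨a, hv a (by simp), rfl⟩
    induction z with
    | h p q =>
      rcases p with a | a <;> rcases q with b | b
      · exact ⟨s(a, b), hI (hv a (by simp)) (hv b (by simp)) (hH hzH.1), rfl⟩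
      · exact (hpend _ _ rfl).elim
      · exact (hpend _ _ Sym2.eq_swap).elim
      · exact (hH hzH.1).elim
  calc K.edgeSet.ncard ≤ _ := Set.ncard_le_ncard hsub (Set.toFinite _)
    _ ≤ _ := Set.ncard_union_le _ _
    _ ≤ _ := by gcongr

/-- A tolerant subgraph keeps many edges of every small induced matching. -/
theorem IsTolerantSubgraph.card_sub_le {α : ℝ} (hα : 0 ≤ α) {f : ℕ} {H : SimpleGraph (U ⊕ U)}
    (h : IsTolerantSubgraph α f (attachPendantMatching G) H) (hM : M.IsMatching)
    (hI : M.IsInduced) (hf : 2 * M.edgeSet.ncard ≤ f) :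
    (Fintype.card U : ℝ) - M.edgeSet.ncard ≤ α * (Fintype.card U - 2 * M.edgeSet.ncard +
      (H.edgeSet ∩ Sym2.map Sum.inl '' M.edgeSet).ncard) := by
  classical
  have h1 := card_le_matchingNumber_attachPendantMatching_deleteEdges hM
  have h2 := matchingNumber_deleteEdges_le_of_isInduced hM hI h.1
  set D : Set (Sym2 (U ⊕ U)) := (fun v => s(Sum.inl v, Sum.inr v)) '' M.verts with hD
  have h3 := h.2 D.toFinset (by
    rw [Set.coe_toFinset]
    rintro _ ⟨v, -, rfl⟩
    rfl) (by
    rw [← Set.ncard_eq_toFinset_card', hD]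
    exact (Set.ncard_image_le (Set.toFinite _)).trans (hM.ncard_verts.trans_le hf))
  rw [Set.coe_toFinset] at h3
  have h1' : (Fintype.card U : ℝ) ≤ matchingNumber ((attachPendantMatching G).deleteEdges D) +
    M.edgeSet.ncard := by exact_mod_cast h1
  have h2' : (matchingNumber (H.deleteEdges D) : ℝ) + 2 * M.edgeSet.ncard ≤
    Fintype.card U + (H.edgeSet ∩ Sym2.map Sum.inl '' M.edgeSet).ncard := by exact_mod_cast h2
  refine le_trans (by linarith) (h3.trans (mul_le_mul_of_nonneg_left ?_ hα))
  linarith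

end PendantMatching

/-! ### Summation over the matchings and the lower bound. -/

/-- The edges of `H` in the matchings of a Ruzsa–Szemerédi graph add up. -/
theorem IsRuzsaSzemeredi.mul_le_ncard_edgeSet {U : Type*} [Finite U] {G : SimpleGraph U} {r t : ℕ}
    (hG : IsRuzsaSzemeredi G r t) {H : SimpleGraph (U ⊕ U)} {y : ℝ}
    (hy : ∀ M : G.Subgraph, M.IsMatching → M.IsInduced → M.edgeSet.ncard = r →
      y ≤ (H.edgeSet ∩ Sym2.map Sum.inl '' M.edgeSet).ncard) :
    t * y ≤ H.edgeSet.ncard := by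
  classical
  have := Fintype.ofFinite U
  obtain ⟨M, hM, hdisj, -⟩ := hG
  let T : Fin t → Finset (Sym2 (U ⊕ U)) := fun i =>
    (H.edgeSet ∩ Sym2.map Sum.inl '' (M i).edgeSet).toFinset
  have hT : ∀ i, (T i).card = (H.edgeSet ∩ Sym2.map Sum.inl '' (M i).edgeSet).ncard := fun i =>
    (Set.ncard_eq_toFinset_card' _).symm
  have hsub : Finset.univ.biUnion T ⊆ H.edgeSet.toFinset := by
    intro z hz
    simp only [Finset.mem_biUnion, T, Set.mem_toFinset] at hz ⊢
    obtain ⟨i, -, hi⟩ := hz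
    exact hi.1
  have hcard := Finset.card_le_card hsub
  rw [Finset.card_biUnion, ← Set.ncard_eq_toFinset_card'] at hcard
  · calc (t : ℝ) * y = ∑ _i : Fin t, y := by simp
      _ ≤ ∑ i : Fin t, ((T i).card : ℝ) := by
        refine Finset.sum_le_sum fun i _ => ?_
        rw [hT]
        exact hy (M i) (hM i).1 (hM i).2.1 (hM i).2.2
      _ ≤ _ := by exact_mod_cast hcard
  · intro i _ j _ hij
    refine Finset.disjoint_left.2 ?_
    intro z hzi hzj
    simp only [T, Set.mem_toFinset] at hzi hzj
    obtain ⟨a, ha, rfl⟩ := hzi.2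
    obtain ⟨b, hb, hab⟩ := hzj.2
    obtain rfl := Sym2.map.injective Sum.inl_injective hab
    exact Set.disjoint_left.1 (hdisj i j hij) ha hb

theorem eventually_rsEdgeBound_le_of_isTolerantSubgraph {ε δ c : ℝ} (hδ0 : 0 < δ) (hδ1 : δ < 1)
    (hδε : δ < ε / 4) (hc : 0 < c) :
    ∀ᶠ N : ℕ in atTop, ∀ (G₁ : SimpleGraph (Fin N)) (t : ℕ),
      (N : ℝ) ^ (c / Real.log (Real.log (N : ℝ))) ≤ (t : ℝ) →
      IsRuzsaSzemeredi G₁ ⌊(1 - δ) * (N : ℝ) / 4⌋₊ t →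
      ∀ f : ℕ, (1 - δ) * ((2 * N : ℕ) : ℝ) / 4 ≤ (f : ℝ) →
      ∀ H : SimpleGraph (Fin N ⊕ Fin N),
        IsTolerantSubgraph (3 / 2 - ε) f (attachPendantMatching G₁) H →
          rsEdgeBound (c / 2) (2 * N) ≤ (H.edgeSet.ncard : ℝ) := by
  -- Capping at `1` keeps `3/2 - ε'` and `2 - 2 * ε'` nonnegative, and a smaller `ε` only weakens
  -- tolerance.
  set ε' := min ε 1 with hε'
  have hε'1 : ε' ≤ 1 := min_le_right _ _
  have hε'ε : ε' ≤ ε := min_le_left _ _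
  have hδε' : δ < ε' := lt_min (by linarith) hδ1
  -- The inequality for `M` gives `3/2 * x ≥ (ε' - δ) * N / 2 - 2`, where `x` counts the edges of
  -- `M` in `H` and the `2` comes from the floor in `r`. Once `N * (ε' - δ) ≥ 8`, the right side is
  -- at least `(ε' - δ) * N / 4`.
  set η := (ε' - δ) / 6 with hη
  have hη0 : 0 < η := by rw [hη]; linarith
  have hK : 1 ≤ max 2 η⁻¹ := le_trans one_le_two (le_max_left _ _)
  have h2N : Tendsto (fun N : ℕ => 2 * N) atTop atTop :=
    tendsto_id.const_mul_atTop' two_pos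
  filter_upwards [h2N.eventually (eventually_mul_rsEdgeBound_le (half_pos hc) (half_lt_self hc) hK),
    tendsto_natCast_atTop_atTop.eventually_ge_atTop (8 / (ε' - δ)), eventually_gt_atTop 0]
    with N h1 h2 hN G₁ t ht hG f hf H hH
  have hN' : (0 : ℝ) < N := by exact_mod_cast hN
  have h3 := h1 N (by omega) (by
    push_cast
    exact mul_le_mul_of_nonneg_right (le_max_left _ _) hN'.le)
  have hH' := hH.mono_left (show 3 / 2 - ε ≤ 3 / 2 - ε' by linarith)
  have hfl : (⌊(1 - δ) * (N : ℝ) / 4⌋₊ : ℝ) ≤ (1 - δ) * N / 4 :=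
    Nat.floor_le (div_nonneg (mul_nonneg (by linarith) hN'.le) (by norm_num))
  have hfl' : (1 - δ) * N / 4 < (⌊(1 - δ) * (N : ℝ) / 4⌋₊ : ℝ) + 1 := Nat.lt_floor_add_one _
  set r := ⌊(1 - δ) * (N : ℝ) / 4⌋₊
  have hrf : 2 * r ≤ f := by
    have : (2 * r : ℝ) ≤ f := by
      push_cast at hf
      linarith
    exact_mod_cast this
  have h8 : 8 ≤ N * (ε' - δ) := by rwa [div_le_iff₀ (by linarith)] at h2
  have hty : (t : ℝ) * (η * N) ≤ H.edgeSet.ncard := by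
    refine hG.mul_le_ncard_edgeSet fun M hM hI hMr => ?_
    have h4 := hH'.card_sub_le (by linarith) hM hI (by rw [hMr]; exact hrf)
    rw [hMr, Fintype.card_fin] at h4
    set x : ℝ := ((H.edgeSet ∩ Sym2.map Sum.inl '' M.edgeSet).ncard : ℝ)
    have hx : 0 ≤ x := Nat.cast_nonneg _
    have hεx : 0 ≤ ε' * x := mul_nonneg (by linarith) hx
    have h5 : (2 - 2 * ε') * ((1 - δ) * N / 4 - 1) ≤ (2 - 2 * ε') * r :=
      mul_le_mul_of_nonneg_left (by linarith) (by linarith)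
    have h6 : 0 ≤ δ * ε' * N := by
      have : 0 < ε' := by linarith
      positivity
    rw [hη]
    nlinarith
  refine le_trans ?_ hty
  have h9 : η⁻¹ * rsEdgeBound (c / 2) (2 * N) ≤ rsEdgeBound c N :=
    le_trans (mul_le_mul_of_nonneg_right (le_max_right _ _)
      (Real.rpow_nonneg (Nat.cast_nonneg _) _)) h3
  rw [inv_mul_le_iff₀ hη0] at h9
  refine h9.trans ?_
  unfold rsEdgeBound
  rw [Real.rpow_add hN', Real.rpow_one]
  calc η * (N * (N : ℝ) ^ (c / Real.log (Real.log (N : ℝ)))) ≤ η * (N * t) := by gcongr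
    _ = t * (η * N) := by ring

/-- Only the lower bound on `f` matters: with `N = n / b` and `b` large, `f n ≥ N` exceeds the
threshold `(1 - δ) * N / 2`. The constant is halved a second time to pay for the isolated vertices.
-/
theorem exists_lowerBoundGraph {ε : ℝ} (hε : 0 < ε) : ∃ c : ℝ, 0 < c ∧
    ∀ f : ℕ → ℕ, (fun n : ℕ => (n : ℝ)) =O[atTop] (fun n => (f n : ℝ)) →
      ∀ᶠ n : ℕ in atTop, ∃ G : SimpleGraph (Fin n), ∀ H : SimpleGraph (Fin n),
        IsTolerantSubgraph (3 / 2 - ε) (f n) G H →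
          rsEdgeBound c n ≤ (H.edgeSet.ncard : ℝ) := by
  set ε' := min ε 1 with hε'
  have hε'1 : ε' ≤ 1 := min_le_right _ _
  have hε'ε : ε' ≤ ε := min_le_left _ _
  have hε'0 : 0 < ε' := lt_min hε one_pos
  have hδ0 : 0 < ε' / 8 := by linarith
  have hδ1 : ε' / 8 < 1 := by linarith
  obtain ⟨c, hc, hRS⟩ := exists_isRuzsaSzemeredi hδ0 hδ1
  refine ⟨c / 2 / 2, by positivity, fun f hf => ?_⟩
  obtain ⟨C, hC0, hC⟩ := hf.exists_pos
  obtain ⟨b, hb⟩ := exists_nat_ge (max C 2)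
  have hbC : C ≤ b := (le_max_left _ _).trans hb
  have hb2 : 2 ≤ b := by exact_mod_cast (le_max_right C 2).trans hb
  have hdiv : Tendsto (fun n : ℕ => n / b) atTop atTop := Nat.tendsto_div_const_atTop (by omega)
  have hlow := eventually_rsEdgeBound_le_of_isTolerantSubgraph (ε := ε') hδ0 hδ1 (by linarith) hc
  have hb1 : (1 : ℝ) ≤ b := by exact_mod_cast (by omega : 1 ≤ b)
  filter_upwards [hdiv.eventually (hRS.and hlow), hC.bound, hdiv.eventually_ge_atTop 1,
    eventually_mul_rsEdgeBound_le (half_pos (half_pos hc)) (half_lt_self (half_pos hc)) hb1]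
    with n hn hfn hn1 hscale
  have hNn : b * (n / b) ≤ n := Nat.mul_div_le n b
  obtain ⟨N, hN⟩ : ∃ N, n / b = N := ⟨_, rfl⟩
  rw [hN] at hn hn1 hNn
  obtain ⟨⟨G₁, t, ht, hG⟩, hlow⟩ := hn
  have h2Nn : 2 * N ≤ n := (Nat.mul_le_mul_right N hb2).trans hNn
  have hnN : n ≤ b * (2 * N) := by
    have := Nat.lt_mul_div_succ n (show 0 < b by omega)
    rw [hN] at this
    nlinarith
  obtain ⟨e⟩ : Nonempty (Fin N ⊕ Fin N ↪ Fin n) := by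
    rw [Function.Embedding.nonempty_iff_card_le]
    simp only [Fintype.card_sum, Fintype.card_fin]
    omega
  refine ⟨(attachPendantMatching G₁).map e, fun H hH => ?_⟩
  have hH' := (hH.mono_left (show 3 / 2 - ε ≤ 3 / 2 - ε' by linarith)).comap (by linarith) e
  have hNf : (N : ℝ) ≤ f n := by
    rw [Real.norm_of_nonneg (Nat.cast_nonneg _), Real.norm_of_nonneg (Nat.cast_nonneg _)] at hfn
    have h1 : (b : ℝ) * N ≤ n := by exact_mod_cast hNn
    have h2 : C * f n ≤ b * f n := by gcongr
    exact le_of_mul_le_mul_left (h1.trans (hfn.trans h2)) (by linarith)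
  have h1 := hlow G₁ t ht hG (f n) (by
    push_cast
    have : (0 : ℝ) ≤ N := Nat.cast_nonneg _
    nlinarith) _ hH'
  have h2 := hscale (2 * N) h2Nn (by exact_mod_cast hnN)
  have h3 : rsEdgeBound (c / 2 / 2) n ≤ b * rsEdgeBound (c / 2 / 2) n :=
    le_mul_of_one_le_left (Real.rpow_nonneg (Nat.cast_nonneg _) _) hb1
  refine h3.trans (h2.trans (h1.trans ?_))
  rw [Nat.cast_le, ← Set.ncard_image_of_injective _ (Sym2.map.injective e.injective)]
  refine Set.ncard_le_ncard ?_ (Set.toFinite _)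
  rintro _ ⟨z, hz, rfl⟩
  induction z with
  | h p q => exact hz

theorem mainTheorem6 :
    -- For `f = Θ(n)`, every `(3/2 - ε)`-approximation `f`-tolerant subgraph of a suitable
    -- `n`-vertex graph has `n ^ (1 + Ω(1 / log log n)) = ω(f)` edges.
    (∀ ε : ℝ, 0 < ε → ∃ c : ℝ, 0 < c ∧
      ∀ f : ℕ → ℕ, (fun n => (f n : ℝ)) =Θ[atTop] (fun n : ℕ => (n : ℝ)) →
        (fun n => (f n : ℝ)) =o[atTop] rsEdgeBound c ∧
        ∀ᶠ n : ℕ in atTop, ∃ G : SimpleGraph (Fin n), ∀ H : SimpleGraph (Fin n),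
          IsTolerantSubgraph (3 / 2 - ε) (f n) G H →
            rsEdgeBound c n ≤ (H.edgeSet.ncard : ℝ)) ∧
    -- Ruzsa–Szemerédi graphs with `N ^ Ω(1 / log log N)` induced matchings of size `(1 - δ) N / 4`
    -- exist.
    (∀ δ : ℝ, 0 < δ → δ < 1 → ∃ c : ℝ, 0 < c ∧ ∀ᶠ N : ℕ in atTop,
      ∃ (G₁ : SimpleGraph (Fin N)) (t : ℕ),
        (N : ℝ) ^ (c / Real.log (Real.log (N : ℝ))) ≤ (t : ℝ) ∧
        IsRuzsaSzemeredi G₁ ⌊(1 - δ) * (N : ℝ) / 4⌋₊ t) ∧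
    -- Each of them, with a pendant perfect matching attached, is a lower-bound graph on `n = 2N`
    -- vertices for every `f ≥ (1 - δ) n / 4`.
    (∀ ε δ c : ℝ, 0 < δ → δ < 1 → δ < ε / 4 → 0 < c → ∃ c' : ℝ, 0 < c' ∧
      ∀ᶠ N : ℕ in atTop, ∀ (G₁ : SimpleGraph (Fin N)) (t : ℕ),
        (N : ℝ) ^ (c / Real.log (Real.log (N : ℝ))) ≤ (t : ℝ) →
        IsRuzsaSzemeredi G₁ ⌊(1 - δ) * (N : ℝ) / 4⌋₊ t →
        ∀ f : ℕ, (1 - δ) * ((2 * N : ℕ) : ℝ) / 4 ≤ (f : ℝ) →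
        ∀ H : SimpleGraph (Fin N ⊕ Fin N),
          IsTolerantSubgraph (3 / 2 - ε) f (attachPendantMatching G₁) H →
            rsEdgeBound c' (2 * N) ≤ (H.edgeSet.ncard : ℝ)) := by
  refine ⟨fun ε hε => ?_, fun δ hδ0 hδ1 => exists_isRuzsaSzemeredi hδ0 hδ1,
    fun ε δ c hδ0 hδ1 hδε hc => ⟨c / 2, half_pos hc,
      eventually_rsEdgeBound_le_of_isTolerantSubgraph hδ0 hδ1 hδε hc⟩⟩
  obtain ⟨c, hc, h⟩ := exists_lowerBoundGraph hε
  exact ⟨c, hc, fun f hf =>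
    ⟨hf.1.trans_isLittleO (natCast_isLittleO_rsEdgeBound hc), h f hf.2⟩⟩
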